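/- **Definition.** Let $F$ be a complete field with a norm $|\cdot|$, $X$ a metric space, $\mu$ a Borel measure on $X$, $U\subseteq X$, and $C,\alpha>0$. A continuous function $f:U\to F$ is $(C,\alpha)$-good on $U$ with respect to $\mu$ if for every open ball $B\subseteq U$ of $X$ centered in $\operatorname{supp}\mu$ and every $\epsilon>0$, $$\mu(\{x\in B:|f(x)|<\epsilon\})\le C\left(\frac{\epsilon}{\|f\|_{\mu,B}}\right)^{\alpha}\mu(B),\qquad \|f\|_{\mu,B}=\sup\{|f(x)|:x\in B\cap\operatorname{supp}\mu\},$$ where the right-hand side is $+\infty$ if $\|f\|_{\mu,B}=0$. **Proposition.** Let $n\in\mathbb N$. 1. (Archimedean case.) There exist $C,\alpha>0$ depending only on $n$ such that for every $\Lambda>0$ there is $\delta_0>0$ with the following property: for all $c_{i,l}\in\mathbb C$, all $\lambda_i\in\mathbb C$ with $|\lambda_i|\le\Lambda$ $(1\le i\le n,\ 0\le l\le n-1)$, and every interval $I\subset\mathbb R$ of length at most $\delta_0$, the function $$f(s)=\sum_{i=1}^n\sum_{l=0}^{n-1}c_{i,l}\,s^l e^{\lambda_i s},\qquad s\in I,$$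 is $(C,\alpha)$-good on $I$ with respect to Lebesgue measure on $\mathbb R$. 2. (Non-Archimedean case.) Let $p$ be a prime, let $F$ be a finite extension of $\mathbb Q_p$ with the norm extending $|\cdot|_p$, and let $\mathcal O_F=\{x\in F:|x|\le1\}$. There exist $k\in\mathbb N$ and $C,\alpha>0$, depending only on $F$ and $n$, such that the exponential series of $\lambda s$ converges for all $\lambda\in p^k\mathcal O_F$ and $s\in\mathbb Z_p$, and for all $c_{i,l}\in F$ and all distinct $\lambda_1,\dots,\lambda_n\in p^k\mathcal O_F$, the function $$f(s)=\sum_{i=1}^n\sum_{l=0}^{n-1}c_{i,l}\,s^l e^{\lambda_i s},\qquad s\in\mathbb Z_p,$$ is $(C,\alpha)$-good on $\mathbb Z_p$ with respect to the Haar measure $\mu$ on $\mathbb Q_p$ normalized by $\mu(\mathbb Z_p)=1$. -/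

import Mathlib

open MeasureTheory
open scoped ENNReal

/-- `‖f‖_{μ,B} = sup {|f x| : x ∈ B ∩ supp μ}`, as an extended nonnegative real. -/
noncomputable def supNormOn {X F : Type*} [PseudoMetricSpace X] [MeasurableSpace X]
    [NormedField F] (μ : Measure X) (B : Set X) (f : X → F) : ℝ≥0∞ :=
  ⨆ x ∈ B ∩ μ.support, ‖f x‖ₑ

/-- `f` is `(C, α)`-good on `U` with respect to `μ`. Only the values of `f` on `U` matter. The
inequality is read in `[0, ∞]`, so it is no condition on a ball on which `f` vanishes
(`ε / 0 = ∞`). -/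
def IsGoodOn {X F : Type*} [PseudoMetricSpace X] [MeasurableSpace X] [NormedField F]
    (C α : ℝ) (μ : Measure X) (U : Set X) (f : X → F) : Prop :=
  ContinuousOn f U ∧
    ∀ x ∈ μ.support, ∀ r > 0, Metric.ball x r ⊆ U → ∀ ε : ℝ, 0 < ε →
      μ {y ∈ Metric.ball x r | ‖f y‖ < ε} ≤
        ENNReal.ofReal C * (ENNReal.ofReal ε / supNormOn μ (Metric.ball x r) f) ^ α *
          μ (Metric.ball x r)

/-- The exponential polynomial `∑_{i=1}^{n} ∑_{l=0}^{n-1} c_{i,l} s^l e^{λ_i s}`. -/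
noncomputable def expPoly {K : Type*} [NormedField K] {n : ℕ} (c : Fin n → Fin n → K)
    (lam : Fin n → K) (s : K) : K :=
  ∑ i : Fin n, ∑ l : Fin n, c i l * s ^ (l : ℕ) * NormedSpace.exp (lam i * s)

/-- The set `p^k O_F`, where `O_F = {x ∈ F : |x| ≤ 1}`. -/
def primePowIntegers (F : Type*) [NormedField F] (p k : ℕ) : Set F :=
  {x | ∃ y : F, ‖y‖ ≤ 1 ∧ x = (p : F) ^ k * y}

/-! Both cases are one argument over a complete normed field `K` of characteristic zero with `‖1/m!‖
≤ M ^ m` (`M = 1` for `ℂ`, `M = p` over `ℚ_[p]`), and no compactness is used. Put `N = n² + 1`.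
After an affine change of variable the ball becomes part of the unit ball and the frequencies become
small: in the real case because the interval is short, in the `p`-adic case because they lie in `p^k
O_F`.

The derivatives at `0` of an exponential polynomial satisfy a linear recurrence of order `N` whose
characteristic roots are `0` and the frequencies. When these are small, every Taylor coefficient of
index at least `N` is tiny compared with the first `N` (`exists_expPoly_hasSum`). Such a function is
almost a polynomial of degree less than `N`, so Lagrange interpolation bounds it on the unit ball by
its values at any `N` separated points (`exists_tail_bound_norm_le`).

If `{‖f‖ < ε}` fills a proportion `t` of the ball, it contains `N` points at mutual distance
comparable to `t` times the radius, since balls of relative radius `d` have relative measure at most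
`d`. Interpolation then gives `sup ‖f‖ ≲ ε t^{-(N-1)}`, which is goodness with exponent `1/N`
(`measure_sublevel_le`); the constants involve `N` only. -/

/-! ### Lagrange interpolation and perturbations of polynomials -/

section Interpolation

open Polynomial Finset

variable {K : Type*} [NormedField K]

/-- Division of `X ^ m` by the nodal polynomial of nodes in the unit ball, with a bound on the
quotient. -/
theorem exists_quotient_nodal {ι : Type*} (s : Finset ι) (v : ι → K)
    (hv : ∀ i ∈ s, ‖v i‖ ≤ 1) (m : ℕ) :
    ∃ q : K[X], (X ^ m - Lagrange.nodal s v * q).degree < (#s : WithBot ℕ) ∧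
      ∀ x : K, ‖x‖ ≤ 1 → ‖q.eval x‖ ≤ 2 ^ m := by
  classical
  induction s using Finset.induction_on generalizing m with
  | empty =>
    refine ⟨X ^ m, by simp, fun x hx => ?_⟩
    simp only [eval_pow, eval_X, norm_pow]
    exact (pow_le_one₀ (norm_nonneg _) hx).trans (one_le_pow₀ (by norm_num))
  | insert a s ha ih =>
    choose q hq hqb using fun m => ih (fun i hi => hv i (mem_insert_of_mem hi)) m
    -- Divide by `X - v a` first, `X^m - a^m = (X - a) ∑ a^{m-1-i} X^i`, then divide each `X^i` by
    -- the nodal polynomial of `s`. The bound propagates because `∑_{i<m} 2^i ≤ 2^m`.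
    refine ⟨∑ i ∈ range m, C (v a ^ (m - 1 - i)) * q i, ?_, fun x hx => ?_⟩
    · have key : (X : K[X]) ^ m - Lagrange.nodal (insert a s) v *
          ∑ i ∈ range m, C (v a ^ (m - 1 - i)) * q i =
          (X - C (v a)) * (∑ i ∈ range m, C (v a ^ (m - 1 - i)) *
            (X ^ i - Lagrange.nodal s v * q i)) + C (v a ^ m) := by
        have hg : (X : K[X]) ^ m - C (v a) ^ m =
            (X - C (v a)) * ∑ i ∈ range m, C (v a ^ (m - 1 - i)) * X ^ i := by
          rw [← (Commute.all (X : K[X]) (C (v a))).mul_geom_sum₂]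
          congr 1
          refine sum_congr rfl fun i _ => ?_
          rw [C_pow, mul_comm]
        rw [Lagrange.nodal_insert_eq_nodal ha]
        simp only [mul_sub, sum_sub_distrib]
        rw [← hg, C_pow, mul_assoc, mul_sum (a := Lagrange.nodal s v)]
        simp only [mul_left_comm (Lagrange.nodal s v)]
        ring
      rw [key, card_insert_of_notMem ha]
      refine (degree_add_le _ _).trans_lt (max_lt ?_ ?_)
      · by_cases h0 : (∑ i ∈ range m, C (v a ^ (m - 1 - i)) *
            (X ^ i - Lagrange.nodal s v * q i)) = 0
        · rw [h0, mul_zero, degree_zero]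
          exact WithBot.bot_lt_coe _
        · have hd : (∑ i ∈ range m, C (v a ^ (m - 1 - i)) *
              (X ^ i - Lagrange.nodal s v * q i)).degree < (#s : WithBot ℕ) := by
            refine (degree_sum_le _ _).trans_lt
              ((Finset.sup_lt_iff (WithBot.bot_lt_coe _)).2 fun i _ => ?_)
            rw [← smul_eq_C_mul]
            exact (degree_smul_le _ _).trans_lt (hq i)
          rw [degree_mul, degree_X_sub_C, degree_eq_natDegree h0]
          rw [degree_eq_natDegree h0] at hd
          have : (∑ i ∈ range m, C (v a ^ (m - 1 - i)) *
              (X ^ i - Lagrange.nodal s v * q i)).natDegree < #s := by exact_mod_cast hd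
          rw [add_comm]
          exact_mod_cast Nat.succ_lt_succ this
      · exact degree_C_le.trans_lt (by exact_mod_cast Nat.succ_pos _)
    · rw [eval_finsetSum]
      calc ‖∑ i ∈ range m, (C (v a ^ (m - 1 - i)) * q i).eval x‖
          ≤ ∑ i ∈ range m, (2 : ℝ) ^ i := by
            refine norm_sum_le_of_le _ fun i _ => ?_
            rw [eval_mul, eval_C, norm_mul, norm_pow]
            have h1 : ‖v a‖ ^ (m - 1 - i) ≤ 1 :=
              pow_le_one₀ (norm_nonneg _) (hv a (mem_insert_self a s))
            calc _ ≤ 1 * (2 : ℝ) ^ i := by gcongr; exact hqb i x hx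
              _ = _ := one_mul _
        _ ≤ 2 ^ m := by
            rw [geom_sum_eq (by norm_num)]
            norm_num

theorem eval_eq_sum_basis {N : ℕ} {v : Fin N → K} (hv : Function.Injective v) {P : K[X]}
    (hP : P.degree < N) (x : K) :
    P.eval x = ∑ i, P.eval (v i) * (Lagrange.basis univ v i).eval x := by
  conv_lhs => rw [Lagrange.eq_interpolate (s := univ) (v := v) (f := P) hv.injOn (by simpa using hP)]
  simp [Lagrange.interpolate_apply, eval_finsetSum]

theorem pow_eq_sum_basis {N : ℕ} {v : Fin N → K} (hv : Function.Injective v) {m : ℕ}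
    (hm : m < N) (x : K) :
    x ^ m = ∑ i, v i ^ m * (Lagrange.basis univ v i).eval x := by
  have := eval_eq_sum_basis hv (P := X ^ m) (by simpa using hm) x
  simpa using this

/-- The error of polynomial interpolation of a monomial. -/
theorem norm_pow_sub_sum_basis_le {N : ℕ} {v : Fin N → K} (hv : Function.Injective v)
    (hv1 : ∀ i, ‖v i‖ ≤ 1) (m : ℕ) {x : K} (hx : ‖x‖ ≤ 1) :
    ‖x ^ m - ∑ i, v i ^ m * (Lagrange.basis univ v i).eval x‖ ≤ 2 ^ (m + N) := by
  -- The remainder of `X^m` modulo the nodal polynomial is its interpolant, so the error is exactly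
  -- nodal polynomial times quotient.
  obtain ⟨q, hq, hqb⟩ := exists_quotient_nodal univ v (fun i _ => hv1 i) m
  have h := eval_eq_sum_basis hv (by simpa using hq) x
  have h' : ∀ i, (X ^ m - Lagrange.nodal univ v * q).eval (v i) = v i ^ m := fun i => by
    simp [Lagrange.eval_nodal_at_node (mem_univ i)]
  simp only [h'] at h
  rw [← h]
  simp only [eval_sub, eval_pow, eval_X, eval_mul, sub_sub_cancel, norm_mul, Lagrange.eval_nodal,
    norm_prod]
  rw [pow_add, mul_comm]
  gcongr
  · exact hqb x hx
  · calc ∏ i, ‖x - v i‖ ≤ ∏ _i : Fin N, (2 : ℝ) := by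
          refine prod_le_prod (fun _ _ => norm_nonneg _) fun i _ => ?_
          linarith [norm_sub_le x (v i), hv1 i]
      _ = 2 ^ N := by simp

theorem norm_eval_basis_le {N : ℕ} {v : Fin N → K} (hv1 : ∀ i, ‖v i‖ ≤ 1) {d : ℝ} (hd : 0 < d)
    (hsep : ∀ i j, i ≠ j → d ≤ ‖v i - v j‖) (i : Fin N) {x : K} (hx : ‖x‖ ≤ 1) :
    ‖(Lagrange.basis univ v i).eval x‖ ≤ (2 / d) ^ (N - 1) := by
  rw [Lagrange.basis, eval_prod, norm_prod]
  calc ∏ j ∈ univ.erase i, ‖(Lagrange.basisDivisor (v i) (v j)).eval x‖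
      ≤ ∏ _j ∈ univ.erase i, (2 / d) := by
        refine prod_le_prod (fun _ _ => norm_nonneg _) fun j hj => ?_
        have h1 := hsep i j (ne_of_mem_erase hj).symm
        simp only [Lagrange.basisDivisor, eval_mul, eval_C, eval_sub, eval_X, norm_mul, norm_inv]
        rw [inv_mul_eq_div]
        gcongr
        linarith [norm_sub_le x (v j), hv1 j]
    _ = (2 / d) ^ (N - 1) := by simp [div_pow]

/-- Interpolation acts termwise on the power series: it is exact on monomials of degree below `N`,
and elsewhere the decay `4^{-m}` beats the error `2^{m+N}`. The separation `d` enters only through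
the size of the Lagrange basis. -/
theorem norm_le_sum_nodes_add {N : ℕ} {a : ℕ → K} {f : K → K}
    (hf : ∀ x : K, ‖x‖ ≤ 1 → HasSum (fun m => a m * x ^ m) (f x)) {B : ℝ} (hB : 0 ≤ B)
    (ha : ∀ m, N ≤ m → ‖a m‖ ≤ B / 4 ^ m) {v : Fin N → K} (hv1 : ∀ i, ‖v i‖ ≤ 1) {d : ℝ}
    (hd : 0 < d) (hsep : ∀ i j, i ≠ j → d ≤ ‖v i - v j‖) {ε : ℝ}
    (hε : ∀ i, ‖f (v i)‖ ≤ ε) {x : K} (hx : ‖x‖ ≤ 1) :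
    ‖f x‖ ≤ N * ε * (2 / d) ^ (N - 1) + 2 ^ (N + 1) * B := by
  have hv : Function.Injective v := fun i j hij => by
    by_contra hne
    have := hsep i j hne
    rw [hij, sub_self, norm_zero] at this
    linarith
  set l : Fin N → K := fun i => (Lagrange.basis univ v i).eval x with hl
  have h1 : HasSum (fun m => a m * (x ^ m - ∑ i, v i ^ m * l i)) (f x - ∑ i, f (v i) * l i) := by
    have := (hf x hx).sub (hasSum_sum fun i (_ : i ∈ univ) => (hf (v i) (hv1 i)).mul_right (l i))
    refine this.congr_fun ?_
    intro m
    rw [mul_sub, mul_sum]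
    simp only [mul_assoc]
  have h2 : HasSum (fun m : ℕ => 2 ^ N * B * (1 / 2 : ℝ) ^ m) (2 ^ N * B * 2) :=
    hasSum_geometric_two.mul_left _
  have h3 : ‖f x - ∑ i, f (v i) * l i‖ ≤ 2 ^ N * B * 2 := by
    rw [← h1.tsum_eq]
    refine tsum_of_norm_bounded h2 fun m => ?_
    rcases lt_or_ge m N with hm | hm
    · rw [← pow_eq_sum_basis hv hm x, sub_self, mul_zero, norm_zero]
      positivity
    · rw [norm_mul]
      calc _ ≤ B / 4 ^ m * 2 ^ (m + N) := by
            gcongr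
            · exact ha m hm
            · exact norm_pow_sub_sum_basis_le hv hv1 m hx
        _ = 2 ^ N * B * (1 / 2) ^ m := by
            have : (4 : ℝ) ^ m = 2 ^ m * 2 ^ m := by rw [← mul_pow]; norm_num
            rw [this, pow_add, one_div, inv_pow]
            field_simp
  have h4 : ‖∑ i, f (v i) * l i‖ ≤ N * ε * (2 / d) ^ (N - 1) := by
    calc _ ≤ ∑ _i : Fin N, ε * (2 / d) ^ (N - 1) := by
          refine norm_sum_le_of_le _ fun i _ => ?_
          rw [norm_mul]
          gcongr
          · exact (norm_nonneg _).trans (hε i)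
          · exact hε i
          · exact norm_eval_basis_le hv1 hd hsep i hx
      _ = _ := by simp [mul_assoc]
  calc ‖f x‖ = ‖∑ i, f (v i) * l i + (f x - ∑ i, f (v i) * l i)‖ := by rw [add_sub_cancel]
    _ ≤ _ := norm_add_le_of_le h4 h3
    _ = _ := by ring

/-- The coefficients of a polynomial of degree less than `N` are controlled by its values at
`N` points. -/
theorem exists_coeff_bound {N : ℕ} {y : Fin N → K} (hy : Function.Injective y) :
    ∃ κ : ℝ, 1 ≤ κ ∧ ∀ (a : ℕ → K) (T : ℝ),
      (∀ i, ‖∑ m ∈ range N, a m * y i ^ m‖ ≤ T) → 0 ≤ T → ∀ j < N, ‖a j‖ ≤ κ * T := by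
  refine ⟨1 + ∑ i, ∑ j ∈ range N, ‖(Lagrange.basis univ y i).coeff j‖,
    le_add_of_nonneg_right (by positivity), fun a T hT hT0 j hj => ?_⟩
  set P : K[X] := ∑ m ∈ range N, C (a m) * X ^ m with hPdef
  have hP : P.degree < N := by
    refine (degree_sum_le _ _).trans_lt
      ((Finset.sup_lt_iff (WithBot.bot_lt_coe _)).2 fun i hi => ?_)
    exact (degree_C_mul_X_pow_le _ _).trans_lt (by exact_mod_cast mem_range.1 hi)
  have hPe : ∀ i, P.eval (y i) = ∑ m ∈ range N, a m * y i ^ m := fun i => by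
    simp [hPdef, eval_finsetSum]
  have hPc : P.coeff j = a j := by
    simp [hPdef, coeff_X_pow, hj]
  have hPi : P = ∑ i, C (P.eval (y i)) * Lagrange.basis univ y i := by
    conv_lhs => rw [Lagrange.eq_interpolate (s := univ) (v := y) (f := P) hy.injOn (by simpa using hP)]
    simp [Lagrange.interpolate_apply]
  rw [← hPc, hPi, finsetSum_coeff]
  calc ‖∑ i, (C (P.eval (y i)) * Lagrange.basis univ y i).coeff j‖
      ≤ ∑ i, (∑ j ∈ range N, ‖(Lagrange.basis univ y i).coeff j‖) * T := by
        refine norm_sum_le_of_le _ fun i _ => ?_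
        rw [coeff_C_mul, norm_mul, mul_comm]
        gcongr
        · exact single_le_sum (f := fun j => ‖(Lagrange.basis univ y i).coeff j‖)
            (fun _ _ => norm_nonneg _) (mem_range.2 hj)
        · rw [hPe]; exact hT i
    _ ≤ _ := by
        rw [← sum_mul, add_mul]
        linarith

/-- A power series whose tail is small compared with its first `N` coefficients is controlled on
the unit ball by its values at any `N` separated points. -/
theorem exists_tail_bound_norm_le {N : ℕ} (hN : 0 < N) {y : Fin N → K}
    (hy : Function.Injective y) (hy1 : ∀ i, ‖y i‖ ≤ 1) :
    ∃ κ > 0, ∀ (a : ℕ → K) (f : K → K),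
      (∀ x : K, ‖x‖ ≤ 1 → HasSum (fun m => a m * x ^ m) (f x)) →
      (∀ A : ℝ, (∀ j < N, ‖a j‖ ≤ A) → ∀ m, N ≤ m → ‖a m‖ ≤ κ * A / 4 ^ m) →
      ∀ v : Fin N → K, (∀ i, ‖v i‖ ≤ 1) → ∀ d : ℝ, 0 < d →
        (∀ i j, i ≠ j → d ≤ ‖v i - v j‖) → ∀ ε : ℝ, (∀ i, ‖f (v i)‖ ≤ ε) →
        ∀ x : K, ‖x‖ ≤ 1 → ‖f x‖ ≤ 2 * N * ε * (2 / d) ^ (N - 1) := by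
  obtain ⟨K₀, hK₀, hcoef⟩ := exists_coeff_bound hy
  have hK₀' : 0 < K₀ := by linarith
  -- The size of `κ` serves twice: `κ * K₀ ≤ 1/8` lets the tail be absorbed in `hAT`, and `2 ^ (N +
  -- 3) * κ * K₀ = 1` makes the interpolation error in `hmain` equal to `T / 2`.
  refine ⟨1 / (2 ^ (N + 3) * K₀), by positivity, fun a f hf ha v hv1 d hd hsep ε hε x hx => ?_⟩
  set κ : ℝ := 1 / (2 ^ (N + 3) * K₀) with hκ
  have : Nonempty (Fin N) := ⟨⟨0, hN⟩⟩
  have hκ0 : 0 < κ := by positivity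
  have hκK : 2 ^ (N + 3) * (κ * K₀) = 1 := by rw [hκ]; field_simp
  obtain ⟨i₀, hi₀⟩ := Finite.exists_max fun i => ‖f (y i)‖
  obtain ⟨j₀, hj₀, hjmax⟩ := (range N).exists_max_image (fun j => ‖a j‖) ⟨0, mem_range.2 hN⟩
  set T := ‖f (y i₀)‖ with hT
  set A := ‖a j₀‖ with hA
  have hA0 : 0 ≤ A := norm_nonneg _
  have hT0 : 0 ≤ T := norm_nonneg _
  have htail := ha A fun j hj => hjmax j (mem_range.2 hj)
  have hP : ∀ i, ‖∑ m ∈ range N, a m * y i ^ m‖ ≤ T + 2 * (κ * A) := by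
    intro i
    have h1 := (hf (y i) (hy1 i)).sub (hasSum_sum_of_ne_finset_zero
      (f := fun m => if m < N then a m * y i ^ m else 0) (s := range N)
      (fun m hm => if_neg (by simpa using hm)))
    have h2 : HasSum (fun m : ℕ => κ * A * (1 / 2 : ℝ) ^ m) (κ * A * 2) :=
      hasSum_geometric_two.mul_left _
    have h3 : ‖f (y i) - ∑ m ∈ range N, if m < N then a m * y i ^ m else 0‖ ≤ κ * A * 2 := by
      rw [← h1.tsum_eq]
      refine tsum_of_norm_bounded h2 fun m => ?_
      split_ifs with hm
      · rw [sub_self, norm_zero]; positivity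
      · rw [sub_zero, norm_mul, norm_pow]
        calc ‖a m‖ * ‖y i‖ ^ m ≤ κ * A / 4 ^ m * 1 := by
              gcongr
              · exact htail m (not_lt.1 hm)
              · exact pow_le_one₀ (norm_nonneg _) (hy1 i)
          _ ≤ κ * A / 2 ^ m * 1 := by gcongr; norm_num
          _ = _ := by rw [one_div, inv_pow]; ring
    rw [sum_congr rfl fun m hm => if_pos (mem_range.1 hm)] at h3
    have h4 := norm_sub_norm_le (∑ m ∈ range N, a m * y i ^ m) (f (y i))
    rw [norm_sub_rev] at h4
    linarith [hi₀ i]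
  have hAT : A ≤ 2 * K₀ * T := by
    have h1 := hcoef a _ hP (by positivity) j₀ (mem_range.1 hj₀)
    have h2 : (8 : ℝ) ≤ 2 ^ (N + 3) := by
      rw [pow_add]
      have := one_le_pow₀ (M₀ := ℝ) (a := 2) (n := N) (by norm_num)
      linarith
    have h3 : κ * K₀ ≤ 1 / 8 := by
      have : 8 * (κ * K₀) ≤ 1 := by
        rw [← hκK]; gcongr
      linarith
    have h4 : κ * K₀ * A ≤ 1 / 8 * A := by gcongr
    nlinarith
  have hmain : ∀ x : K, ‖x‖ ≤ 1 → ‖f x‖ ≤ N * ε * (2 / d) ^ (N - 1) + T / 2 := by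
    intro x hx
    refine (norm_le_sum_nodes_add hf (by positivity) htail hv1 hd hsep hε hx).trans ?_
    have : 2 ^ (N + 1) * (κ * A) ≤ T / 2 := by
      calc 2 ^ (N + 1) * (κ * A) ≤ 2 ^ (N + 1) * (κ * (2 * K₀ * T)) := by gcongr
        _ = 2 ^ (N + 3) * (κ * K₀) * (T / 2) := by ring
        _ = T / 2 := by rw [hκK, one_mul]
    linarith
  -- Evaluating `hmain` where `T` is attained absorbs `T / 2` and bounds `T` itself by the values at
  -- the nodes `v`.
  have h1 := hmain (y i₀) (hy1 i₀)
  have h2 := hmain x hx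
  rw [← hT] at h1
  linarith

end Interpolation

/-! ### Taylor coefficients of exponential polynomials and their recurrence -/

section PowerSeries

open Polynomial Finset
open scoped Nat

variable {K : Type*} [NormedField K]

/-- The shift operator on sequences. -/
noncomputable def seqShift (K : Type*) [NormedField K] : Module.End K (ℕ → K) :=
  LinearMap.funLeft K K Nat.succ

theorem seqShift_apply (β : ℕ → K) (m : ℕ) : seqShift K β m = β (m + 1) := rfl

theorem seqShift_pow_apply (j : ℕ) (β : ℕ → K) (m : ℕ) : (seqShift K ^ j) β m = β (m + j) := by
  induction j generalizing m with
  | zero => rfl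
  | succ j ih => rw [pow_succ', Module.End.mul_apply, seqShift_apply, ih]; congr 1; ring

theorem aeval_seqShift_apply (χ : K[X]) (β : ℕ → K) (m : ℕ) :
    aeval (seqShift K) χ β m = ∑ j ∈ range (χ.natDegree + 1), χ.coeff j * β (m + j) := by
  rw [aeval_eq_sum_range, LinearMap.sum_apply, Finset.sum_apply]
  simp [seqShift_pow_apply]

/-- The sequence `m ↦ (m choose l) μ ^ (m - l)`. -/
def binomSeq (μ : K) (l m : ℕ) : K := m.choose l * μ ^ (m - l)

theorem aeval_seqShift_binomSeq_zero (μ : K) :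
    aeval (seqShift K) (X - C μ) (binomSeq μ 0) = 0 := by
  funext m
  simp [binomSeq, seqShift_apply, pow_succ']

theorem aeval_seqShift_binomSeq_succ (μ : K) (l : ℕ) :
    aeval (seqShift K) (X - C μ) (binomSeq μ (l + 1)) = binomSeq μ l := by
  funext m
  simp only [binomSeq, map_sub, aeval_X, aeval_C, LinearMap.sub_apply, Pi.sub_apply,
    seqShift_apply, Module.algebraMap_end_apply, Pi.smul_apply, smul_eq_mul, Nat.choose_succ_succ,
    Nat.cast_add, Nat.add_sub_add_right]
  rcases lt_or_ge m (l + 1) with h | h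
  · simp [Nat.choose_eq_zero_of_lt h]
  · obtain ⟨k, rfl⟩ := Nat.exists_eq_add_of_le h
    rw [show l + 1 + k - (l + 1) = k by omega, show l + 1 + k - l = k + 1 by omega]
    ring

/-- By Pascal's rule `X - μ` lowers the index `l` by one, and it kills index `0`; these sequences
form a Jordan chain of the shift. -/
theorem aeval_seqShift_pow_binomSeq (μ : K) {l n : ℕ} (h : l < n) :
    aeval (seqShift K) ((X - C μ) ^ n) (binomSeq μ l) = 0 := by
  induction l generalizing n with
  | zero =>
    obtain ⟨n, rfl⟩ := Nat.exists_eq_add_of_lt h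
    rw [pow_succ, map_mul, Module.End.mul_apply, aeval_seqShift_binomSeq_zero, map_zero]
  | succ l ih =>
    obtain ⟨n, rfl⟩ : ∃ k, n = k + 1 := ⟨n - 1, by omega⟩
    rw [pow_succ, map_mul, Module.End.mul_apply, aeval_seqShift_binomSeq_succ, ih (by omega)]

/-- Decay of the solutions of a linear recurrence with small characteristic roots. -/
theorem norm_le_of_aeval_seqShift_eq_zero {χ : K[X]} (hmonic : χ.Monic) (hsplit : χ.Splits)
    {η θ : ℝ} (hη : 0 ≤ η) (hroots : ∀ z ∈ χ.roots, ‖z‖ ≤ η)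
    (hηθ : η * 2 ^ χ.natDegree ≤ θ) (hθ1 : θ ≤ 1) {β : ℕ → K}
    (hβ : aeval (seqShift K) χ β = 0) {B : ℝ} (hB : ∀ j < χ.natDegree, ‖β j‖ ≤ B)
    (hB0 : 0 ≤ B) (i : ℕ) : ‖β i‖ ≤ θ ^ (i + 1 - χ.natDegree) * B := by
  set N := χ.natDegree with hN
  have hθ0 : 0 ≤ θ := le_trans (by positivity) hηθ
  have hη' : η ≤ θ / 2 ^ N := by rwa [le_div_iff₀ (by positivity)]
  induction i using Nat.strong_induction_on with
  | _ i ih =>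
    rcases lt_or_ge i N with hi | hi
    · rw [Nat.sub_eq_zero_of_le hi, pow_zero, one_mul]
      exact hB i hi
    · obtain ⟨m, rfl⟩ := Nat.exists_eq_add_of_le hi
      have hrec : β (N + m) = -∑ j ∈ range N, χ.coeff j * β (m + j) := by
        have h := congrFun hβ m
        rw [aeval_seqShift_apply, sum_range_succ, hmonic.coeff_natDegree, one_mul, ← hN] at h
        rw [add_comm N m, eq_neg_iff_add_eq_zero, add_comm]
        exact h
      -- The factor `2 ^ N` between `η` and `θ` is reserved to cancel the sum of the binomial
      -- coefficients in the recurrence.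
      have hcoef : ∀ j < N, ‖χ.coeff j‖ ≤ θ ^ (N - j) / 2 ^ N * N.choose j := by
        intro j hj
        have h := Polynomial.coeff_le_of_roots_le (p := χ) (f := RingHom.id K) (B := η) j hmonic
          (by simpa using hsplit) (by simpa using hroots)
        rw [Polynomial.map_id] at h
        refine h.trans ?_
        gcongr
        calc η ^ (N - j) ≤ (θ / 2 ^ N) ^ (N - j) := by gcongr
          _ = θ ^ (N - j) / (2 ^ N) ^ (N - j) := div_pow _ _ _
          _ ≤ θ ^ (N - j) / 2 ^ N := by
            gcongr
            exact le_self_pow₀ (one_le_pow₀ (by norm_num)) (by omega)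
      rw [hrec, norm_neg, show N + m + 1 - N = m + 1 by omega]
      calc ‖∑ j ∈ range N, χ.coeff j * β (m + j)‖
          ≤ ∑ j ∈ range N, θ ^ (m + 1) * B / 2 ^ N * N.choose j := by
            refine norm_sum_le_of_le _ fun j hj => ?_
            have hj := mem_range.1 hj
            rw [norm_mul]
            calc ‖χ.coeff j‖ * ‖β (m + j)‖
                ≤ (θ ^ (N - j) / 2 ^ N * N.choose j) * (θ ^ (m + j + 1 - N) * B) := by
                  gcongr
                  · exact hcoef j hj
                  · exact ih _ (by omega)
              _ = θ ^ (N - j + (m + j + 1 - N)) * B / 2 ^ N * N.choose j := by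
                  rw [pow_add]; ring
              _ ≤ θ ^ (m + 1) * B / 2 ^ N * N.choose j := by
                  have := pow_le_pow_of_le_one hθ0 hθ1
                    (show m + 1 ≤ N - j + (m + j + 1 - N) by omega)
                  gcongr
        _ = θ ^ (m + 1) * B / 2 ^ N * (∑ j ∈ range N, N.choose j : ℕ) := by
            rw [Nat.cast_sum, mul_sum]
        _ ≤ θ ^ (m + 1) * B / 2 ^ N * (2 ^ N : ℕ) := by
            gcongr
            rw [← Nat.sum_range_choose N]
            exact sum_le_sum_of_subset (range_subset_range.2 (Nat.le_succ _))
        _ = θ ^ (m + 1) * B := by push_cast; field_simp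

theorem norm_pow_div_factorial_le {M : ℝ} (hM : ∀ m : ℕ, ‖((m ! : ℕ) : K)⁻¹‖ ≤ M ^ m) (x : K)
    (m : ℕ) : ‖x ^ m / (m ! : ℕ)‖ ≤ (‖x‖ * M) ^ m := by
  rw [div_eq_mul_inv, norm_mul, norm_pow, mul_pow]
  gcongr
  exact hM m

/-- Affine change of variable in an exponential polynomial. -/
theorem exists_expPoly_affine {n : ℕ} (c : Fin n → Fin n → K) (lam : Fin n → K) (x₀ ρ : K) :
    ∃ c' : Fin n → Fin n → K, ∀ t : K,
      (∀ i, NormedSpace.exp (lam i * (x₀ + ρ * t)) =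
        NormedSpace.exp (lam i * x₀) * NormedSpace.exp (lam i * ρ * t)) →
      expPoly c lam (x₀ + ρ * t) = expPoly c' (fun i => lam i * ρ) t := by
  set P : Fin n → K[X] := fun i => ∑ l : Fin n, C (c i l) * (C x₀ + C ρ * X) ^ (l : ℕ) with hP
  have hdeg : ∀ i, (P i).degree < n := fun i => by
    refine (degree_sum_le _ _).trans_lt
      ((Finset.sup_lt_iff (WithBot.bot_lt_coe _)).2 fun l _ => ?_)
    rw [← smul_eq_C_mul]
    refine (degree_smul_le _ _).trans_lt ?_
    refine (degree_pow_le _ _).trans_lt ?_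
    have h1 : (C x₀ + C ρ * X : K[X]).degree ≤ 1 := by
      refine (degree_add_le _ _).trans (max_le (degree_C_le.trans (by norm_num)) ?_)
      exact (degree_C_mul_X_le _)
    refine (nsmul_le_nsmul_right h1 _).trans_lt ?_
    rw [nsmul_one]
    exact_mod_cast l.2
  refine ⟨fun i l => NormedSpace.exp (lam i * x₀) * (P i).coeff l, fun t ht => ?_⟩
  simp only [expPoly]
  refine sum_congr rfl fun i _ => ?_
  rw [ht i, ← sum_mul, ← sum_mul]
  have h1 : ∑ l : Fin n, c i l * (x₀ + ρ * t) ^ (l : ℕ) = (P i).eval t := by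
    simp [hP, eval_finsetSum]
  have h2 : (P i).eval t = ∑ l : Fin n, (P i).coeff l * t ^ (l : ℕ) := by
    rw [Fin.sum_univ_eq_sum_range (fun l => (P i).coeff l * t ^ l) n]
    by_cases h0 : P i = 0
    · simp [h0]
    · exact eval_eq_sum_range' ((natDegree_lt_iff_degree_lt h0).2 (hdeg i)) t
  rw [h1, h2]
  simp only [mul_assoc, ← mul_sum]
  ring

variable [CompleteSpace K]

theorem summable_pow_div_factorial {M : ℝ} (hM0 : 0 ≤ M)
    (hM : ∀ m : ℕ, ‖((m ! : ℕ) : K)⁻¹‖ ≤ M ^ m) {x : K} (hx : ‖x‖ * M < 1) :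
    Summable fun m : ℕ => x ^ m / ((m ! : ℕ) : K) :=
  Summable.of_norm_bounded (summable_geometric_of_lt_one (by positivity) hx)
    (norm_pow_div_factorial_le hM x)

variable [CharZero K]

theorem hasSum_exp_of_factorial_bound {M : ℝ} (hM0 : 0 ≤ M)
    (hM : ∀ m : ℕ, ‖((m ! : ℕ) : K)⁻¹‖ ≤ M ^ m) {x : K} (hx : ‖x‖ * M < 1) :
    HasSum (fun m : ℕ => x ^ m / ((m ! : ℕ) : K)) (NormedSpace.exp x) := by
  rw [NormedSpace.exp_eq_tsum_div]
  exact (summable_pow_div_factorial hM0 hM hx).hasSum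

/-- The coefficient is `μ^{m-l}/(m-l)!`, which vanishes for `m < l`. Written over `m!`, its
numerator is `l!` times `binomSeq μ l`, to which the shift recurrence applies. -/
theorem hasSum_binomSeq {M : ℝ} (hM0 : 0 ≤ M) (hM : ∀ m : ℕ, ‖((m ! : ℕ) : K)⁻¹‖ ≤ M ^ m)
    {μ : K} (hμ : ‖μ‖ * M < 1) (l : ℕ) {x : K} (hx : ‖x‖ ≤ 1) :
    HasSum (fun m : ℕ => (l ! : ℕ) * binomSeq μ l m / (m ! : ℕ) * x ^ m)
      (x ^ l * NormedSpace.exp (μ * x)) := by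
  have hμx : ‖μ * x‖ * M < 1 := by
    refine lt_of_le_of_lt ?_ hμ
    rw [norm_mul]
    gcongr
    exact mul_le_of_le_one_right (norm_nonneg _) hx
  have h := (hasSum_exp_of_factorial_bound hM0 hM hμx).mul_left (x ^ l)
  have h0 : ∑ i ∈ range l, ((l ! : ℕ) * binomSeq μ l i / (i ! : ℕ) * x ^ i : K) = 0 :=
    sum_eq_zero fun i hi => by
      simp [binomSeq, Nat.choose_eq_zero_of_lt (mem_range.1 hi)]
  rw [← add_zero (x ^ l * NormedSpace.exp (μ * x)), ← h0, ← hasSum_nat_add_iff]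
  refine h.congr_fun fun k => ?_
  have h1 : (((k + l).choose l : ℕ) : K) * (k ! : ℕ) * (l ! : ℕ) = ((k + l)! : ℕ) := by
    have := Nat.add_choose_mul_factorial_mul_factorial k l
    exact_mod_cast this
  have h2 : ((k ! : ℕ) : K) ≠ 0 := by exact_mod_cast Nat.factorial_ne_zero k
  have h3 : (((k + l)! : ℕ) : K) ≠ 0 := by exact_mod_cast Nat.factorial_ne_zero _
  rw [binomSeq, Nat.add_sub_cancel, mul_pow, pow_add]
  field_simp
  rw [← h1]
  ring

/-- An exponential polynomial with small frequencies is a power series whose tail is small compared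
with its first coefficients. -/
theorem exists_expPoly_hasSum (n : ℕ) {M : ℝ} (hM1 : 1 ≤ M)
    (hM : ∀ m : ℕ, ‖((m ! : ℕ) : K)⁻¹‖ ≤ M ^ m) {κ : ℝ} (hκ : 0 < κ) :
    ∃ η > 0, η * M < 1 ∧ ∀ (c : Fin n → Fin n → K) (μ : Fin n → K), (∀ i, ‖μ i‖ ≤ η) →
      ∃ a : ℕ → K, (∀ x : K, ‖x‖ ≤ 1 → HasSum (fun m => a m * x ^ m) (expPoly c μ x)) ∧
        ∀ A : ℝ, (∀ j < n * n + 1, ‖a j‖ ≤ A) →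
          ∀ m, n * n + 1 ≤ m → ‖a m‖ ≤ κ * A / 4 ^ m := by
  set N := n * n + 1 with hN
  have hM0 : 0 < M := by linarith
  set τ : ℝ := min κ 1 / N ! with hτ
  have hfac : (1 : ℝ) ≤ N ! := by exact_mod_cast Nat.factorial_pos N
  have hτ0 : 0 < τ := div_pos (lt_min hκ one_pos) (by linarith)
  have hτ1 : τ ≤ 1 := div_le_one_of_le₀ ((min_le_right _ _).trans hfac) (by linarith)
  have hτκ : τ * N ! ≤ κ := by
    rw [hτ, div_mul_cancel₀ _ (by positivity)]
    exact min_le_left _ _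
  -- For `m ≥ N` one has `N (m + 1 - N) ≥ m`, so `θ ^ (m + 1 - N) ≤ τ / (4 * M) ^ m`: `M ^ m` pays
  -- for `1/m!`, `4 ^ m` is the wanted decay, and the `N !` in `τ` pays for passing from `a j` to `β
  -- j = j! a j`.
  set θ : ℝ := τ / (4 * M) ^ N with hθ
  have hθ0 : 0 < θ := by positivity
  have h4M : 4 * M ≤ (4 * M) ^ N := le_self_pow₀ (by linarith) (by omega)
  have hθ4 : θ * (4 * M) ≤ 1 := by
    rw [hθ, div_mul_eq_mul_div, div_le_one (by positivity)]
    nlinarith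
  have hθ1 : θ ≤ 1 := by nlinarith
  have h2N : (1 : ℝ) ≤ 2 ^ N := one_le_pow₀ (by norm_num)
  have hηθ : θ / 2 ^ N ≤ θ := div_le_self hθ0.le h2N
  have hηM : θ / 2 ^ N * M < 1 := by
    calc θ / 2 ^ N * M ≤ θ * M := by gcongr
      _ < 1 := by linarith
  refine ⟨θ / 2 ^ N, by positivity, hηM, fun c μ hμ => ?_⟩
  set β : ℕ → K := ∑ i, ∑ l : Fin n, (c i l * ((l : ℕ)! : ℕ)) • binomSeq (μ i) l with hβ
  -- The extra factor `X` adds the harmless root `0` and keeps the degree `n * n + 1` positive even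
  -- for `n = 0`.
  set χ : K[X] := X * ∏ i, (X - C (μ i)) ^ n with hχ
  have hmonic : χ.Monic := monic_X.mul (monic_prod_of_monic _ _ fun i _ => (monic_X_sub_C _).pow n)
  have hdeg : χ.natDegree = N := by
    rw [hχ, natDegree_X_mul (monic_prod_of_monic _ _ fun i _ => (monic_X_sub_C _).pow n).ne_zero,
      natDegree_prod_of_monic _ _ fun i _ => (monic_X_sub_C _).pow n]
    simp [hN]
  have hsplit : χ.Splits :=
    Splits.X.mul (Splits.prod fun i _ => (Splits.X_sub_C _).pow n)
  have hroots : ∀ z ∈ χ.roots, ‖z‖ ≤ θ / 2 ^ N := by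
    intro z hz
    have hz := (mem_roots'.1 hz).2
    simp only [IsRoot, hχ, eval_mul, eval_X, eval_prod, eval_pow, eval_sub, eval_C, mul_eq_zero,
      prod_eq_zero_iff] at hz
    rcases hz with rfl | ⟨i, -, hi⟩
    · rw [norm_zero]; positivity
    · rw [sub_eq_zero.1 ((pow_eq_zero_iff (Fin.pos i).ne').1 hi)]
      exact hμ i
  have hkill : aeval (seqShift K) χ β = 0 := by
    rw [hβ, map_sum]
    refine sum_eq_zero fun i _ => ?_
    rw [map_sum]
    refine sum_eq_zero fun l _ => ?_
    obtain ⟨q, hq⟩ : (X - C (μ i)) ^ n ∣ χ :=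
      (dvd_prod_of_mem _ (mem_univ i)).mul_left X
    rw [map_smul, hq, mul_comm _ q, map_mul, Module.End.mul_apply,
      aeval_seqShift_pow_binomSeq _ l.2, map_zero, smul_zero]
  refine ⟨fun m => β m / (m ! : ℕ), fun x hx => ?_, fun A hA m hm => ?_⟩
  · have hsum : HasSum (fun m : ℕ => ∑ i, ∑ l : Fin n,
        c i l * (((l : ℕ)! : ℕ) * binomSeq (μ i) l m / (m ! : ℕ) * x ^ m))
        (∑ i, ∑ l : Fin n, c i l * (x ^ (l : ℕ) * NormedSpace.exp (μ i * x))) :=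
      hasSum_sum fun i _ => hasSum_sum fun l _ => (hasSum_binomSeq hM0.le hM
        (lt_of_le_of_lt (by gcongr; exact hμ i) hηM) l hx).mul_left _
    have hval : expPoly c μ x =
        ∑ i, ∑ l : Fin n, c i l * (x ^ (l : ℕ) * NormedSpace.exp (μ i * x)) := by
      simp only [expPoly, mul_assoc]
    rw [hval]
    refine hsum.congr_fun fun m => ?_
    simp only [hβ, Finset.sum_apply, Pi.smul_apply, smul_eq_mul, sum_div, sum_mul]
    refine sum_congr rfl fun i _ => sum_congr rfl fun l _ => ?_
    ring
  · have hA0 : 0 ≤ A := (norm_nonneg _).trans (hA 0 (by omega))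
    have hB : ∀ j < χ.natDegree, ‖β j‖ ≤ N ! * A := by
      intro j hj
      rw [hdeg] at hj
      have h2 : ((j ! : ℕ) : K) ≠ 0 := by exact_mod_cast Nat.factorial_ne_zero j
      have h3 : ‖((j ! : ℕ) : K)‖ ≤ N ! := by
        refine (Nat.norm_cast_le _).trans ?_
        rw [norm_one, mul_one]
        exact_mod_cast Nat.factorial_le hj.le
      calc ‖β j‖ = ‖((j ! : ℕ) : K)‖ * ‖β j / (j ! : ℕ)‖ := by
            rw [← norm_mul, mul_div_cancel₀ _ h2]
        _ ≤ N ! * A := by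
            gcongr
            exact hA j hj
    have hdecay := norm_le_of_aeval_seqShift_eq_zero hmonic hsplit (by positivity) hroots
      (by rw [hdeg, div_mul_cancel₀ _ (by positivity)]) hθ1 hkill hB (by positivity) m
    rw [hdeg] at hdecay
    have hθm : θ ^ (m + 1 - N) ≤ τ / (4 * M) ^ m := by
      rw [hθ, div_pow, ← pow_mul]
      gcongr
      · exact pow_le_of_le_one hτ0.le hτ1 (by omega)
      · linarith
      · obtain ⟨k, rfl⟩ := Nat.exists_eq_add_of_le hm
        rw [show N + k + 1 - N = k + 1 by omega]
        nlinarith [Nat.zero_le (n * n * k)]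
    calc ‖β m / (m ! : ℕ)‖ = ‖β m‖ * ‖((m ! : ℕ) : K)⁻¹‖ := by rw [div_eq_mul_inv, norm_mul]
      _ ≤ (τ / (4 * M) ^ m * (N ! * A)) * M ^ m := by
          gcongr
          · exact hdecay.trans (by gcongr)
          · exact hM m
      _ = τ * N ! * A / 4 ^ m := by
          rw [mul_pow]; field_simp
      _ ≤ κ * A / 4 ^ m := by gcongr

/-- On the unit ball, an exponential polynomial with small frequencies is controlled by its values
at `n * n + 1` separated points. -/
theorem exists_norm_expPoly_le (n : ℕ) {M : ℝ} (hM1 : 1 ≤ M)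
    (hM : ∀ m : ℕ, ‖((m ! : ℕ) : K)⁻¹‖ ≤ M ^ m) {y : Fin (n * n + 1) → K}
    (hy : Function.Injective y) (hy1 : ∀ i, ‖y i‖ ≤ 1) :
    ∃ η > 0, η * M < 1 ∧ ∀ (c : Fin n → Fin n → K) (μ : Fin n → K), (∀ i, ‖μ i‖ ≤ η) →
      ∀ v : Fin (n * n + 1) → K, (∀ i, ‖v i‖ ≤ 1) → ∀ d : ℝ, 0 < d →
        (∀ i j, i ≠ j → d ≤ ‖v i - v j‖) → ∀ ε : ℝ, (∀ i, ‖expPoly c μ (v i)‖ ≤ ε) →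
        ∀ x : K, ‖x‖ ≤ 1 →
          ‖expPoly c μ x‖ ≤ 2 * (n * n + 1 : ℕ) * ε * (2 / d) ^ (n * n) := by
  obtain ⟨κ, hκ, hmain⟩ := exists_tail_bound_norm_le (Nat.succ_pos _) hy hy1
  obtain ⟨η, hη, hηM, hser⟩ := exists_expPoly_hasSum n hM1 hM hκ
  refine ⟨η, hη, hηM, fun c μ hμ => ?_⟩
  obtain ⟨a, ha, htail⟩ := hser c μ hμ
  exact hmain a _ ha htail

end PowerSeries

/-! ### From separated points to measures of sublevel sets -/

section Sublevel

open Metric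

/-- A set of large measure contains many separated points. -/
theorem exists_separated_points {X : Type*} [PseudoMetricSpace X] [MeasurableSpace X]
    (μ : Measure X) {E : Set X} {s : ℝ} {b : ℝ≥0∞} (hb : ∀ x, μ (ball x s) ≤ b) (N : ℕ)
    (hE : N * b < μ E) :
    ∃ u : Fin N → X, (∀ i, u i ∈ E) ∧ ∀ i j, i ≠ j → s ≤ dist (u i) (u j) := by
  induction N with
  | zero => exact ⟨Fin.elim0, fun i => i.elim0, fun i => i.elim0⟩
  | succ N ih =>
    have hle : (N : ℝ≥0∞) * b < μ E :=
      lt_of_le_of_lt (by gcongr; exact Nat.le_succ N) hE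
    obtain ⟨u, huE, hu⟩ := ih hle
    have hcover : μ (⋃ i, ball (u i) s) ≤ N * b := by
      refine (measure_iUnion_fintype_le μ _).trans ?_
      refine (Finset.sum_le_sum fun i _ => hb (u i)).trans ?_
      simp
    -- Greedy choice: the balls around the points already chosen have too little measure to cover
    -- `E`.
    obtain ⟨x, hxE, hx⟩ : ∃ x ∈ E, x ∉ ⋃ i, ball (u i) s := by
      by_contra! h
      exact absurd (measure_mono (μ := μ) h) (not_le.2 (hcover.trans_lt hle))
    have hx' : ∀ i, s ≤ dist x (u i) := by simpa using hx
    refine ⟨Fin.cons x u, fun i => ?_, fun i j hij => ?_⟩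
    · refine Fin.cases ?_ (fun i => ?_) i
      · simpa using hxE
      · simpa using huE i
    · induction i using Fin.cases with
      | zero =>
        induction j using Fin.cases with
        | zero => exact absurd rfl hij
        | succ j => simpa using hx' j
      | succ i =>
        induction j using Fin.cases with
        | zero => simpa [dist_comm] using hx' i
        | succ j => simpa using hu i j fun h => hij (by rw [h])

/-- If a function is controlled on `B` by its values at any `N` separated points, then its
sublevel sets in `B` are small. -/
theorem measure_sublevel_le {X F : Type*} [PseudoMetricSpace X] [MeasurableSpace X]
    [NormedField F] {μ : Measure X} {B : Set X} (hB0 : μ B ≠ 0) (hBtop : μ B ≠ ∞) {f : X → F}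
    {ε R : ℝ} (hε : 0 < ε) {N : ℕ} (hN : 0 < N)
    (hball : ∀ x, ∀ d : ℝ, 0 < d → d ≤ 1 → μ (ball x (d * R)) ≤ ENNReal.ofReal d * μ B)
    (hf : ∀ d : ℝ, 0 < d → ∀ u : Fin N → X, (∀ i, u i ∈ B) →
      (∀ i j, i ≠ j → d * R ≤ dist (u i) (u j)) → (∀ i, ‖f (u i)‖ ≤ ε) →
      ∀ x ∈ B, ‖f x‖ ≤ 2 * N * ε * (2 / d) ^ (N - 1)) :
    μ {y ∈ B | ‖f y‖ < ε} ≤ ENNReal.ofReal (8 * N ^ 2) *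
      (ENNReal.ofReal ε / supNormOn μ B f) ^ (1 / N : ℝ) * μ B := by
  set E := {y ∈ B | ‖f y‖ < ε} with hEdef
  have hEB : E ⊆ B := fun y hy => hy.1
  by_cases hE0 : μ E = 0
  · rw [hE0]; exact zero_le
  have hN1 : (1 : ℝ) ≤ N := by exact_mod_cast hN
  have hEle : μ E ≤ μ B := measure_mono hEB
  have hEtop : μ E ≠ ∞ := ne_top_of_le_ne_top hBtop hEle
  have hquot_top : μ E / μ B ≠ ∞ := ENNReal.div_ne_top hEtop hB0
  set t := (μ E / μ B).toReal with ht
  have ht0 : 0 < t := ENNReal.toReal_pos (ENNReal.div_ne_zero.2 ⟨hE0, hBtop⟩) hquot_top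
  have ht1 : t ≤ 1 := by
    rw [ht, ← ENNReal.toReal_one]
    exact ENNReal.toReal_mono ENNReal.one_ne_top (ENNReal.div_le_of_le_mul (by rwa [one_mul]))
  have hEt : μ E = ENNReal.ofReal t * μ B := by
    rw [ht, ENNReal.ofReal_toReal hquot_top, ENNReal.div_mul_cancel hB0 hBtop]
  -- With this `d`, `N` balls of radius `d * R` have total measure at most half of `μ E`.
  set d := t / (2 * N) with hd
  have hd0 : 0 < d := by positivity
  have hd1 : d ≤ 1 := div_le_one_of_le₀ (by linarith) (by positivity)
  have hNd : (N : ℝ≥0∞) * (ENNReal.ofReal d * μ B) < μ E := by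
    rw [hEt, ← mul_assoc]
    refine ENNReal.mul_lt_mul_left hB0 hBtop ?_
    rw [← ENNReal.ofReal_natCast, ← ENNReal.ofReal_mul (by positivity)]
    refine (ENNReal.ofReal_lt_ofReal_iff ht0).2 ?_
    have : (N : ℝ) * d = t / 2 := by rw [hd]; field_simp
    linarith
  obtain ⟨u, huE, hu⟩ := exists_separated_points μ (fun x => hball x d hd0 hd1) N hNd
  set S := 2 * N * ε * (2 / d) ^ (N - 1) with hS
  have hS0 : 0 < S := by positivity
  have hsup : supNormOn μ B f ≤ ENNReal.ofReal S := by
    refine iSup₂_le fun x hx => ?_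
    rw [← ofReal_norm]
    exact ENNReal.ofReal_le_ofReal
      (hf d hd0 u (fun i => hEB (huE i)) hu (fun i => (huE i).2.le) x hx.1)
  have hreal : t ≤ 8 * N ^ 2 * (ε / S) ^ (1 / N : ℝ) := by
    -- In fact `ε / S = (d / 2) ^ (N - 1) / (2 * N)`; the loss makes the left side a perfect `N`-th
    -- power. Since `t = 2 * N * d`, this yields the constant `8 * N ^ 2`.
    have h1 : (d / (4 * N)) ^ N ≤ ε / S := by
      have h2 : ε / S = (d / 2) ^ (N - 1) / (2 * N) := by
        have hz : (2 / d) ^ (N - 1) ≠ 0 := by positivity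
        rw [hS, ← inv_div 2 d, inv_pow]
        generalize (2 / d) ^ (N - 1) = z at hz
        field_simp
      rw [h2]
      have h3 : d / (4 * N) = d / 2 * (1 / (2 * N)) := by field_simp; norm_num
      have h4 : 1 / (2 * N : ℝ) ≤ 1 := div_le_one_of_le₀ (by linarith) (by positivity)
      calc (d / (4 * N)) ^ N = (d / 2) ^ N * (1 / (2 * N)) ^ N := by rw [h3, mul_pow]
        _ ≤ (d / 2) ^ (N - 1) * (1 / (2 * N)) := by
          gcongr ?_ * ?_
          · exact pow_le_pow_of_le_one (by positivity) (by linarith) (Nat.sub_le _ _)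
          · exact pow_le_of_le_one (by positivity) h4 hN.ne'
        _ = _ := by ring
    have h5 : d / (4 * N) ≤ (ε / S) ^ (1 / N : ℝ) := by
      calc d / (4 * N) = ((d / (4 * N)) ^ N) ^ (1 / N : ℝ) := by
            rw [one_div, Real.pow_rpow_inv_natCast (by positivity) hN.ne']
        _ ≤ _ := Real.rpow_le_rpow (by positivity) h1 (by positivity)
    calc t = 8 * N ^ 2 * (d / (4 * N)) := by rw [hd]; field_simp; norm_num
      _ ≤ _ := by gcongr
  rw [hEt]
  gcongr
  calc ENNReal.ofReal t ≤ ENNReal.ofReal (8 * N ^ 2 * (ε / S) ^ (1 / N : ℝ)) :=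
        ENNReal.ofReal_le_ofReal hreal
    _ = ENNReal.ofReal (8 * N ^ 2) * (ENNReal.ofReal ε / ENNReal.ofReal S) ^ (1 / N : ℝ) := by
        rw [ENNReal.ofReal_mul (by positivity), ← ENNReal.ofReal_div_of_pos hS0,
          ENNReal.ofReal_rpow_of_pos (by positivity)]
    _ ≤ _ := by gcongr

/-- The sublevel estimate for exponential polynomials, over any complete field in which the
factorials are not too small. -/
theorem exists_measure_expPoly_sublevel_le (n : ℕ) {k K : Type*} [NormedField k] [NormedField K]
    [NormedAlgebra k K] [CompleteSpace K] [CharZero K] {M : ℝ} (hM1 : 1 ≤ M)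
    (hM : ∀ m : ℕ, ‖((m.factorial : ℕ) : K)⁻¹‖ ≤ M ^ m) {y : Fin (n * n + 1) → K}
    (hy : Function.Injective y) (hy1 : ∀ i, ‖y i‖ ≤ 1) :
    ∃ η > 0, η * M < 1 ∧ ∀ (c : Fin n → Fin n → K) (lam : Fin n → K) (x₀ ρ : k), ρ ≠ 0 →
      (∀ i, ‖lam i‖ * ‖ρ‖ ≤ η) →
      (∀ i, ∀ t : k, ‖t‖ ≤ 1 →
        NormedSpace.exp (lam i * (algebraMap k K x₀ + algebraMap k K ρ * algebraMap k K t)) =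
          NormedSpace.exp (lam i * algebraMap k K x₀) *
            NormedSpace.exp (lam i * algebraMap k K ρ * algebraMap k K t)) →
      ∀ [MeasurableSpace k] (μ : Measure k) (B : Set k), (∀ x ∈ B, ‖x - x₀‖ ≤ ‖ρ‖) →
        μ B ≠ 0 → μ B ≠ ∞ →
        (∀ x, ∀ d : ℝ, 0 < d → d ≤ 1 → μ (ball x (d * ‖ρ‖)) ≤ ENNReal.ofReal d * μ B) →
        ∀ ε : ℝ, 0 < ε →
          μ {s ∈ B | ‖expPoly c lam (algebraMap k K s)‖ < ε} ≤
            ENNReal.ofReal (8 * (n * n + 1 : ℕ) ^ 2) *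
              (ENNReal.ofReal ε / supNormOn μ B fun s => expPoly c lam (algebraMap k K s)) ^
                (1 / (n * n + 1 : ℕ) : ℝ) * μ B := by
  obtain ⟨η, hη, hηM, hmain⟩ := exists_norm_expPoly_le n hM1 hM hy hy1
  refine ⟨η, hη, hηM, fun c lam x₀ ρ hρ hlam hexp _ μ B hB hB0 hBtop hball ε hε => ?_⟩
  -- The substitution `x = x₀ + ρ t` keeps the class of functions, multiplies the frequencies by `ρ`
  -- and divides distances by `‖ρ‖`.
  obtain ⟨c', hc'⟩ := exists_expPoly_affine c lam (algebraMap k K x₀) (algebraMap k K ρ)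
  have hρ0 : 0 < ‖ρ‖ := norm_pos_iff.2 hρ
  have hnorm : ∀ x ∈ B, ‖(x - x₀) / ρ‖ ≤ 1 := fun x hx => by
    rw [norm_div]
    exact div_le_one_of_le₀ (hB x hx) (norm_nonneg _)
  have hval : ∀ x ∈ B, expPoly c lam (algebraMap k K x) =
      expPoly c' (fun i => lam i * algebraMap k K ρ) (algebraMap k K ((x - x₀) / ρ)) := by
    intro x hx
    rw [← hc' _ fun i => hexp i _ (hnorm x hx), ← map_mul, ← map_add, mul_div_cancel₀ _ hρ,
      add_sub_cancel]
  refine measure_sublevel_le hB0 hBtop hε (Nat.succ_pos _) hball fun d hd u hu hsep hfu x hx => ?_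
  rw [hval x hx]
  refine hmain c' _ (fun i => ?_) (fun i => algebraMap k K ((u i - x₀) / ρ)) (fun i => ?_) d hd
    (fun i j hij => ?_) ε (fun i => ?_) _ ?_
  · rw [norm_mul, norm_algebraMap']
    exact hlam i
  · rw [norm_algebraMap']
    exact hnorm _ (hu i)
  · rw [← map_sub, norm_algebraMap', ← sub_div, sub_sub_sub_cancel_right, norm_div,
      le_div_iff₀ hρ0, ← dist_eq_norm]
    exact hsep i j hij
  · rw [← hval _ (hu i)]
    exact hfu i
  · rw [norm_algebraMap']
    exact hnorm x hx

end Sublevel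

/-! ### The real case -/

section Archimedean

theorem norm_inv_factorial_complex_le (m : ℕ) :
    ‖((m.factorial : ℕ) : ℂ)⁻¹‖ ≤ (1 : ℝ) ^ m := by
  rw [one_pow, norm_inv, Complex.norm_natCast]
  exact inv_le_one_of_one_le₀ (by exact_mod_cast m.factorial_pos)

theorem continuous_expPoly_complex {n : ℕ} (c : Fin n → Fin n → ℂ) (lam : Fin n → ℂ) :
    Continuous (expPoly c lam) := by
  have h : Continuous (NormedSpace.exp : ℂ → ℂ) := NormedSpace.exp_continuous
  unfold expPoly
  fun_prop

theorem exists_isGoodOn_expPoly_real (n : ℕ) {Λ : ℝ} (hΛ : 0 < Λ) :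
    ∃ δ₀ > 0, ∀ (c : Fin n → Fin n → ℂ) (lam : Fin n → ℂ), (∀ i, ‖lam i‖ ≤ Λ) →
      ∀ I : Set ℝ, volume I ≤ ENNReal.ofReal δ₀ →
        IsGoodOn (8 * (n * n + 1 : ℕ) ^ 2) (1 / (n * n + 1 : ℕ)) volume I
          (fun s : ℝ => expPoly c lam (s : ℂ)) := by
  set y : Fin (n * n + 1) → ℂ := fun i => (i : ℕ) / (n * n + 1 : ℕ) with hy
  have hN0 : ((n * n + 1 : ℕ) : ℂ) ≠ 0 := Nat.cast_ne_zero.2 (Nat.succ_ne_zero _)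
  have hyinj : Function.Injective y := fun i j hij => by
    simp only [hy] at hij
    rw [div_left_inj' hN0] at hij
    exact Fin.ext (by exact_mod_cast hij)
  have hy1 : ∀ i, ‖y i‖ ≤ 1 := fun i => by
    simp only [hy]
    rw [norm_div, Complex.norm_natCast, Complex.norm_natCast]
    exact div_le_one_of_le₀ (by exact_mod_cast i.2.le) (by positivity)
  obtain ⟨η, hη, -, hmain⟩ := exists_measure_expPoly_sublevel_le n (k := ℝ) le_rfl
    norm_inv_factorial_complex_le hyinj hy1
  refine ⟨η / Λ, by positivity, fun c lam hlam I hI => ⟨?_, fun x _ r hr hball ε hε => ?_⟩⟩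
  · exact ((continuous_expPoly_complex c lam).comp Complex.continuous_ofReal).continuousOn
  -- A ball of radius `r` has length `2 * r`, so a short `I` forces the rescaled frequencies `lam i
  -- * r` below `η`.
  · have hrδ : r ≤ η / Λ := by
      have h := (measure_mono hball).trans hI
      rw [Real.volume_ball, ENNReal.ofReal_le_ofReal_iff (by positivity)] at h
      linarith
    refine hmain c lam x r hr.ne' (fun i => ?_) (fun i t _ => ?_) volume _ (fun z hz => ?_) ?_ ?_
      (fun z d hd _ => ?_) ε hε
    · rw [Real.norm_of_nonneg hr.le]
      calc ‖lam i‖ * r ≤ Λ * (η / Λ) := by gcongr; exact hlam i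
        _ = η := mul_div_cancel₀ _ hΛ.ne'
    · rw [← NormedSpace.exp_add]
      congr 1
      ring
    · rw [Real.norm_of_nonneg hr.le, ← dist_eq_norm]
      exact (Metric.mem_ball.1 hz).le
    · rw [Real.volume_ball]
      exact (ENNReal.ofReal_pos.2 (by positivity)).ne'
    · rw [Real.volume_ball]
      exact ENNReal.ofReal_ne_top
    · rw [Real.norm_of_nonneg hr.le, Real.volume_ball, Real.volume_ball,
        ← ENNReal.ofReal_mul hd.le]
      exact ENNReal.ofReal_le_ofReal (by linarith)

end Archimedean

/-! ### `p`-adic exponentials, balls and Haar measure -/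

section NonArchimedean

open Metric

variable {p : ℕ} [hp : Fact p.Prime]

theorem norm_inv_factorial_padic_le (F : Type*) [NormedField F] [NormedAlgebra ℚ_[p] F] (m : ℕ) :
    ‖((m.factorial : ℕ) : F)⁻¹‖ ≤ (p : ℝ) ^ m := by
  have hp1 : (1 : ℝ) ≤ p := by exact_mod_cast hp.out.one_lt.le
  rw [← map_natCast (algebraMap ℚ_[p] F), norm_inv, norm_algebraMap',
    Padic.norm_eq_zpow_neg_valuation (by exact_mod_cast m.factorial_ne_zero),
    Padic.valuation_natCast, zpow_neg, inv_inv, zpow_natCast]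
  exact pow_le_pow_right₀ hp1 (padicValNat_factorial_le p m)

theorem inv_prime_le_radius_expSeries (F : Type*) [NormedField F] [NormedAlgebra ℚ_[p] F] :
    ENNReal.ofReal (p : ℝ)⁻¹ ≤ (NormedSpace.expSeries ℚ_[p] F).radius := by
  have hp0 : (0 : ℝ) < p := by exact_mod_cast hp.out.pos
  refine FormalMultilinearSeries.le_radius_of_bound _ 1 fun m => ?_
  rw [Real.coe_toNNReal _ (by positivity), NormedSpace.expSeries, norm_smul,
    ContinuousMultilinearMap.norm_mkPiAlgebraFin, mul_one, inv_pow]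
  calc _ ≤ (p : ℝ) ^ m * ((p : ℝ) ^ m)⁻¹ := by
        gcongr
        exact norm_inv_factorial_padic_le ℚ_[p] m
    _ = 1 := mul_inv_cancel₀ (by positivity)

theorem mem_eball_radius_expSeries {F : Type*} [NormedField F] [NormedAlgebra ℚ_[p] F] {x : F}
    (hx : ‖x‖ * p < 1) :
    x ∈ Metric.eball (0 : F) (NormedSpace.expSeries ℚ_[p] F).radius := by
  have hp0 : (0 : ℝ) < p := by exact_mod_cast hp.out.pos
  rw [Metric.mem_eball, edist_zero_right, ← ofReal_norm]
  refine lt_of_lt_of_le ?_ (inv_prime_le_radius_expSeries F)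
  rw [ENNReal.ofReal_lt_ofReal_iff (by positivity), inv_eq_one_div, lt_div_iff₀ hp0]
  exact hx

theorem norm_le_of_mem_primePowIntegers {F : Type*} [NormedField F] [NormedAlgebra ℚ_[p] F]
    {k : ℕ} {x : F} (hx : x ∈ primePowIntegers F p k) : ‖x‖ ≤ ((p : ℝ)⁻¹) ^ k := by
  obtain ⟨y, hy, rfl⟩ := hx
  rw [← map_natCast (algebraMap ℚ_[p] F), ← map_pow, norm_mul, norm_algebraMap', norm_pow,
    Padic.norm_p]
  exact mul_le_of_le_one_right (by positivity) hy

/-- Norms on `ℚ_[p]` are discrete. Replacing `r` by an attained value `‖ρ‖` allows rescaling by `ρ`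
and is needed in `measure_ball_padic_le`, which can fail for the nominal radius `r`. -/
theorem ball_padic_eq_closedBall (x : ℚ_[p]) {r : ℝ} (hr : 0 < r) :
    ∃ ρ : ℚ_[p], ρ ≠ 0 ∧ ball x r = closedBall x ‖ρ‖ := by
  have hp1 : (1 : ℝ) < p := by exact_mod_cast hp.out.one_lt
  obtain ⟨l, hl, hl'⟩ := exists_mem_Ioc_zpow hr hp1
  have hρ : ‖(p : ℚ_[p]) ^ (-l)‖ = (p : ℝ) ^ l := by rw [Padic.norm_p_zpow, neg_neg]
  refine ⟨(p : ℚ_[p]) ^ (-l), zpow_ne_zero _ (by exact_mod_cast hp.out.ne_zero), ?_⟩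
  ext z
  rw [mem_ball, mem_closedBall, hρ, dist_eq_norm]
  exact ⟨fun h => (Padic.norm_le_pow_iff_norm_lt_pow_add_one _ _).2 (h.trans_le hl'),
    fun h => h.trans_lt hl⟩

variable [MeasurableSpace ℚ_[p]] [BorelSpace ℚ_[p]] (μ : Measure ℚ_[p]) [μ.IsAddHaarMeasure]

/-- A ball of `ℚ_[p]` contains `p ^ i` disjoint balls of radius `p ^ i` times smaller. -/
theorem pow_mul_measure_closedBall_le (x x₀ ρ : ℚ_[p]) (hρ : ρ ≠ 0) (i : ℕ) :
    (p : ℝ≥0∞) ^ i * μ (closedBall x (‖ρ‖ * (p : ℝ) ^ (-i : ℤ))) ≤ μ (closedBall x₀ ‖ρ‖) := by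
  have hp1 : (1 : ℝ) ≤ p := by exact_mod_cast hp.out.one_lt.le
  have hρ0 : 0 < ‖ρ‖ := norm_pos_iff.2 hρ
  set s := ‖ρ‖ * (p : ℝ) ^ (-i : ℤ) with hs
  have hsle : s ≤ ‖ρ‖ :=
    mul_le_of_le_one_right hρ0.le (zpow_le_one_of_nonpos₀ hp1 (by simp))
  have htrans : ∀ z, μ (closedBall z s) = μ (closedBall x s) := fun z => by
    rw [Measure.addHaar_closedBall_center, Measure.addHaar_closedBall_center μ x]
  -- Balls of equal radius coincide or are disjoint; if two of these coincided, `p ^ i` would divide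
  -- `j - j'`, which is smaller than `p ^ i` in absolute value.
  have hdisj : Pairwise (Function.onFun Disjoint
      fun j : Fin (p ^ i) => closedBall (x₀ + ρ * ((j : ℕ) : ℚ_[p])) s) := by
    intro j j' hjj'
    rcases IsUltrametricDist.closedBall_eq_or_disjoint (x₀ + ρ * ((j : ℕ) : ℚ_[p]))
      (x₀ + ρ * ((j' : ℕ) : ℚ_[p])) s with h | h
    · exfalso
      have hmem : x₀ + ρ * ((j : ℕ) : ℚ_[p]) ∈ closedBall (x₀ + ρ * ((j' : ℕ) : ℚ_[p])) s := by
        rw [← h]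
        exact mem_closedBall_self (by positivity)
      rw [mem_closedBall, dist_eq_norm, add_sub_add_left_eq_sub, ← mul_sub, norm_mul, hs,
        mul_le_mul_iff_right₀ hρ0] at hmem
      have hdvd := (Padic.norm_int_le_pow_iff_dvd (p := p) ((j : ℕ) - (j' : ℕ) : ℤ) i).1
        (by push_cast; exact hmem)
      have : ((j : ℕ) : ℤ) - (j' : ℕ) = 0 := by
        refine Int.eq_zero_of_abs_lt_dvd hdvd ?_
        have h1 := j.2
        have h2 := j'.2
        rw [abs_lt]
        constructor <;> · zify at h1 h2; omega
      exact hjj' (Fin.ext (by omega))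
    · exact h
  calc (p : ℝ≥0∞) ^ i * μ (closedBall x s)
      = ∑ j : Fin (p ^ i), μ (closedBall (x₀ + ρ * ((j : ℕ) : ℚ_[p])) s) := by
        simp [htrans]
    _ = μ (⋃ j : Fin (p ^ i), closedBall (x₀ + ρ * ((j : ℕ) : ℚ_[p])) s) := by
        rw [measure_iUnion hdisj fun _ => measurableSet_closedBall, tsum_fintype]
    _ ≤ μ (closedBall x₀ ‖ρ‖) := by
        refine measure_mono (Set.iUnion_subset fun j z hz => ?_)
        rw [mem_closedBall, dist_eq_norm] at hz ⊢
        have h1 : z - x₀ = (z - (x₀ + ρ * ((j : ℕ) : ℚ_[p]))) + ρ * ((j : ℕ) : ℚ_[p]) := by ring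
        rw [h1]
        refine (Padic.nonarchimedean _ _).trans (max_le (hz.trans hsle) ?_)
        rw [norm_mul]
        exact mul_le_of_le_one_right hρ0.le (by exact_mod_cast Padic.norm_int_le_one (j : ℕ))

/-- Relative to `‖ρ‖`, norms below `d` are at most the largest power `p^{-i} < d`, and a ball of
that relative radius has relative measure at most `p^{-i}`. -/
theorem measure_ball_padic_le (x x₀ ρ : ℚ_[p]) (hρ : ρ ≠ 0) {d : ℝ} (hd : 0 < d) (hd1 : d ≤ 1) :
    μ (ball x (d * ‖ρ‖)) ≤ ENNReal.ofReal d * μ (closedBall x₀ ‖ρ‖) := by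
  have hp1 : (1 : ℝ) < p := by exact_mod_cast hp.out.one_lt
  have hp0 : (0 : ℝ) < p := by linarith
  have hρ0 : 0 < ‖ρ‖ := norm_pos_iff.2 hρ
  obtain ⟨l, hl, hl'⟩ := exists_mem_Ioc_zpow hd hp1
  obtain ⟨i, rfl⟩ : ∃ i : ℕ, l = -i := by
    refine ⟨(-l).toNat, ?_⟩
    have : l < 0 := by
      by_contra! h
      exact absurd (hl.trans_le hd1) (not_lt.2 (one_le_zpow₀ hp1.le h))
    omega
  have hsub : ball x (d * ‖ρ‖) ⊆ closedBall x (‖ρ‖ * (p : ℝ) ^ (-i : ℤ)) := by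
    intro z hz
    rw [mem_ball, dist_eq_norm] at hz
    have h1 : ‖(z - x) / ρ‖ < d := by rwa [norm_div, div_lt_iff₀ hρ0]
    have h2 := (Padic.norm_le_pow_iff_norm_lt_pow_add_one _ _).2 (h1.trans_le hl')
    rw [norm_div, div_le_iff₀ hρ0] at h2
    rw [mem_closedBall, dist_eq_norm, mul_comm]
    exact h2
  have hpi : (p : ℝ≥0∞) ^ i ≠ 0 := pow_ne_zero _ (by exact_mod_cast hp.out.ne_zero)
  have hpi' : (p : ℝ≥0∞) ^ i ≠ ∞ := ENNReal.pow_ne_top (ENNReal.natCast_ne_top p)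
  calc μ (ball x (d * ‖ρ‖)) ≤ μ (closedBall x (‖ρ‖ * (p : ℝ) ^ (-i : ℤ))) := measure_mono hsub
    _ ≤ ((p : ℝ≥0∞) ^ i)⁻¹ * μ (closedBall x₀ ‖ρ‖) := by
        rw [← ENNReal.mul_le_iff_le_inv hpi hpi']
        exact pow_mul_measure_closedBall_le μ x x₀ ρ hρ i
    _ ≤ ENNReal.ofReal d * μ (closedBall x₀ ‖ρ‖) := by
        gcongr
        have : ((p : ℝ≥0∞) ^ i)⁻¹ = ENNReal.ofReal ((p : ℝ) ^ (-i : ℤ)) := by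
          rw [zpow_neg, zpow_natCast, ENNReal.ofReal_inv_of_pos (by positivity),
            ENNReal.ofReal_pow hp0.le, ENNReal.ofReal_natCast]
        rw [this]
        exact ENNReal.ofReal_le_ofReal hl.le

end NonArchimedean

/-! ### The `p`-adic case -/

section PadicGood

open Metric

variable {p : ℕ} [hp : Fact p.Prime]

theorem continuousOn_expPoly_padic {F : Type*} [NormedField F] [NormedAlgebra ℚ_[p] F]
    [CompleteSpace F] {n : ℕ} (c : Fin n → Fin n → F) {lam : Fin n → F}
    (hlam : ∀ i, ‖lam i‖ * p < 1) :
    ContinuousOn (fun s : ℚ_[p] => expPoly c lam (algebraMap ℚ_[p] F s))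
      (PadicInt.subring p : Set ℚ_[p]) := by
  unfold expPoly
  refine continuousOn_finsetSum _ fun i _ => continuousOn_finsetSum _ fun l _ => ?_
  refine ContinuousOn.mul (by fun_prop) ?_
  refine (NormedSpace.continuousOn_exp (𝕂 := ℚ_[p]) (𝔸 := F)).comp (by fun_prop) fun s hs => ?_
  refine mem_eball_radius_expSeries (lt_of_le_of_lt ?_ (hlam i))
  rw [norm_mul, norm_algebraMap']
  gcongr
  exact mul_le_of_le_one_right (norm_nonneg _) hs

theorem exists_isGoodOn_expPoly_padic (n p : ℕ) [hp : Fact p.Prime] (F : Type*) [NormedField F]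
    [NormedAlgebra ℚ_[p] F] [FiniteDimensional ℚ_[p] F] :
    ∃ k : ℕ,
      (∀ x ∈ primePowIntegers F p k, ∀ s ∈ (PadicInt.subring p : Set ℚ_[p]),
        Summable fun m : ℕ => (x * algebraMap ℚ_[p] F s) ^ m / (m.factorial : F)) ∧
      ∀ (c : Fin n → Fin n → F) (lam : Fin n → F), (∀ i, lam i ∈ primePowIntegers F p k) →
        ∀ [MeasurableSpace ℚ_[p]] [BorelSpace ℚ_[p]] (μ : Measure ℚ_[p])
          [μ.IsAddHaarMeasure], μ (PadicInt.subring p : Set ℚ_[p]) ≠ ∞ →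
          IsGoodOn (8 * (n * n + 1 : ℕ) ^ 2) (1 / (n * n + 1 : ℕ)) μ
            (PadicInt.subring p : Set ℚ_[p])
            (fun s : ℚ_[p] => expPoly c lam (algebraMap ℚ_[p] F s)) := by
  have : CompleteSpace F := FiniteDimensional.complete ℚ_[p] F
  have : CharZero F := charZero_of_injective_algebraMap (algebraMap ℚ_[p] F).injective
  have hp1 : (1 : ℝ) < p := by exact_mod_cast hp.out.one_lt
  have hp0 : (0 : ℝ) < p := by linarith
  set y : Fin (n * n + 1) → F := fun i => algebraMap ℚ_[p] F ((i : ℕ) : ℚ_[p]) with hy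
  have hyinj : Function.Injective y := fun i j hij => by
    have h := (algebraMap ℚ_[p] F).injective hij
    exact Fin.ext (by exact_mod_cast h)
  have hy1 : ∀ i, ‖y i‖ ≤ 1 := fun i => by
    simp only [hy]
    rw [norm_algebraMap']
    exact_mod_cast Padic.norm_int_le_one (i : ℕ)
  obtain ⟨η, hη, hηp, hmain⟩ := exists_measure_expPoly_sublevel_le n (k := ℚ_[p]) hp1.le
    (norm_inv_factorial_padic_le F) hyinj hy1
  -- `p ^ (-k) < η` makes the frequencies small enough for the sublevel estimate; as `η * p < 1`, it
  -- also makes the exponential series converge on `ℤ_p`.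
  obtain ⟨k, hk⟩ := exists_pow_lt_of_lt_one hη (inv_lt_one_of_one_lt₀ hp1)
  have hle : ∀ x ∈ primePowIntegers F p k, ‖x‖ ≤ η := fun x hx =>
    (norm_le_of_mem_primePowIntegers hx).trans hk.le
  have hsmall : ∀ x ∈ primePowIntegers F p k, ∀ s : ℚ_[p], ‖s‖ ≤ 1 →
      ‖x * algebraMap ℚ_[p] F s‖ * p < 1 := by
    intro x hx s hs
    refine lt_of_le_of_lt ?_ hηp
    rw [norm_mul, norm_algebraMap']
    gcongr
    exact (mul_le_of_le_one_right (norm_nonneg _) hs).trans (hle x hx)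
  refine ⟨k, fun x hx s hs => summable_pow_div_factorial hp0.le (norm_inv_factorial_padic_le F)
    (hsmall x hx s hs), fun c lam hlam _ _ μ _ hμ => ⟨?_, fun x₀ _ r hr hball ε hε => ?_⟩⟩
  · refine continuousOn_expPoly_padic c fun i => ?_
    simpa using hsmall _ (hlam i) 1 (by simp)
  · obtain ⟨ρ, hρ, hBρ⟩ := ball_padic_eq_closedBall x₀ hr
    have hx₀ : ‖x₀‖ ≤ 1 := hball (mem_ball_self hr)
    have hx₀ρ : ‖x₀ + ρ‖ ≤ 1 := hball (by rw [hBρ, mem_closedBall, dist_eq_norm]; simp)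
    have hρ1 : ‖ρ‖ ≤ 1 := by
      have h := Padic.nonarchimedean (x₀ + ρ) (-x₀)
      rw [norm_neg, add_neg_cancel_comm] at h
      exact h.trans (max_le hx₀ρ hx₀)
    refine hmain c lam x₀ ρ hρ (fun i => ?_) (fun i t ht => ?_) μ _ (fun z hz => ?_)
      (measure_ball_pos μ x₀ hr).ne' (ne_top_of_le_ne_top hμ (measure_mono hball))
      (fun z d hd hd1 => ?_) ε hε
    · exact (mul_le_of_le_one_right (norm_nonneg _) hρ1).trans (hle _ (hlam i))
    -- Additivity of `exp` holds here because both arguments lie in the disc of convergence.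
    · rw [mul_add, ← mul_assoc]
      refine NormedSpace.exp_add_of_mem_ball (𝕂 := ℚ_[p])
        (mem_eball_radius_expSeries (hsmall _ (hlam i) _ hx₀)) (mem_eball_radius_expSeries ?_)
      rw [mul_assoc, ← map_mul]
      refine hsmall _ (hlam i) _ ?_
      rw [norm_mul]
      exact mul_le_one₀ hρ1 (norm_nonneg _) ht
    · rwa [hBρ, mem_closedBall, dist_eq_norm] at hz
    · rw [hBρ]
      exact measure_ball_padic_le μ z x₀ ρ hρ hd hd1

end PadicGood

theorem proposition2p2 (n : ℕ) :
    -- Archimedean case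
    (∃ C > 0, ∃ α > 0, ∀ Λ : ℝ, 0 < Λ → ∃ δ₀ > 0,
      ∀ (c : Fin n → Fin n → ℂ) (lam : Fin n → ℂ), (∀ i, ‖lam i‖ ≤ Λ) →
      ∀ I : Set ℝ, I.OrdConnected → volume I ≤ ENNReal.ofReal δ₀ →
        IsGoodOn C α volume I (fun s : ℝ => expPoly c lam (s : ℂ))) ∧
    -- non-Archimedean case
    (∀ (p : ℕ) [Fact p.Prime] (F : Type*) [NormedField F] [NormedAlgebra ℚ_[p] F]
      [FiniteDimensional ℚ_[p] F],
      ∃ k : ℕ,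
        -- the exponentials `e^{λ s}` make sense
        (∀ x ∈ primePowIntegers F p k, ∀ s ∈ (PadicInt.subring p : Set ℚ_[p]),
          Summable fun m : ℕ => (x * algebraMap ℚ_[p] F s) ^ m / (m.factorial : F)) ∧
        ∃ C > 0, ∃ α > 0,
          ∀ (c : Fin n → Fin n → F) (lam : Fin n → F), Function.Injective lam →
          (∀ i, lam i ∈ primePowIntegers F p k) →
          ∀ [MeasurableSpace ℚ_[p]] [BorelSpace ℚ_[p]] (μ : Measure ℚ_[p])
            [μ.IsAddHaarMeasure], μ (PadicInt.subring p : Set ℚ_[p]) = 1 →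
            IsGoodOn C α μ (PadicInt.subring p : Set ℚ_[p])
              (fun s : ℚ_[p] => expPoly c lam (algebraMap ℚ_[p] F s))) := by
  refine ⟨⟨8 * (n * n + 1 : ℕ) ^ 2, by positivity, 1 / (n * n + 1 : ℕ), by positivity,
    fun Λ hΛ => ?_⟩, fun p _ F _ _ _ => ?_⟩
  · obtain ⟨δ₀, hδ₀, h⟩ := exists_isGoodOn_expPoly_real n hΛ
    exact ⟨δ₀, hδ₀, fun c lam hlam I _ hI => h c lam hlam I hI⟩
  · obtain ⟨k, hk, h⟩ := exists_isGoodOn_expPoly_padic n p F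
    refine ⟨k, hk, 8 * (n * n + 1 : ℕ) ^ 2, by positivity, 1 / (n * n + 1 : ℕ), by positivity,
      fun c lam _ hlam _ _ μ _ hμ => h c lam hlam μ ?_⟩
    rw [hμ]
    exact ENNReal.one_ne_top
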